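/- **Notation.** For a function $G:\mathbb R\to\mathbb R$ put $Q_G(p)=\sup\{x: G(x)\le p\}$ and $Q_G^-(p)=\sup\{x: G(x)<p\}$ (values in $[-\infty,\infty]$, $\sup\emptyset=-\infty$, infinite levels $p$ allowed). Let $X_1,X_2,\dots$ be i.i.d. real random variables with arbitrary law $F$, with empirical distribution functions $\hat F_i$, and write $\hat Q_i=Q_{\hat F_i}$, $\hat Q_i^-=Q^-_{\hat F_i}$, $Q=Q_F$. Fix $\alpha,\delta,\tilde\delta\in(0,1)$, put $p=\alpha/2$, and fix integers $1\le m_0\le m\le M$ ($m$ is the waiting time, $M$ the cutoff). For $s,\eta>1$, $L\ge 1$, $t\ge L$ and $d\in(0,1)$ let $$g_{s,\eta}(t,L,p,d)=\frac1t\Big[\sqrt{k_1^2p(1-p)\,t\,\ell(t)+k_2^2c_p^2\ell(t)^2}+c_pk_2\ell(t)\Big],\qquad \ell(t)=s\log\log\frac{\eta t}{L}+\log\frac{2\zeta(s)}{d\log^s\eta},$$ $k_1=(\eta^{1/4}+\eta^{-1/4})/\sqrt2$, $k_2=(\sqrt\eta+1)/2$, $c_p=(1-2p)/3$. Fix $s,\eta,s',\eta'>1$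 and put $g_t=g_{s,\eta}(t,m_0,p,\delta/4)$ and $g^{\mathrm{tail}}_t=g_{s',\eta'}(t,M,p,\delta/4)$. **Simulation.** Let $\nu$ be any law on $\mathbb R$ with $\nu((-\infty,Q_\nu(p)])=p$ (for instance any continuous law; $\nu=F$ is allowed if $F$ is continuous). For $Y_1,Y_2,\dots$ i.i.d. with law $\nu$ let $$S_t=\sum_{j=1}^t\big(\mathbb I_{Y_j\le Q_\nu(p)}-p\big),\qquad Z=\min_{m\le t\le M}\frac{S_t}{t\,g_t}.$$ Let $\mathbf Z=(Z_1,\dots,Z_N)$ be i.i.d. copies of $Z$, independent of the data $X_1,X_2,\dots$, with empirical upper quantile function $\hat Q_{\mathbf Z}$. Put $q=\delta/4$, let $\varepsilon>0$ satisfy $$\exp\Big(-N\,q(1-q)\,h\Big(\frac{\varepsilon}{q(1-q)}\Big)\Big)\le\tilde\delta,\qquad h(u)=(1+u)\log(1+u)-u,$$ and let $c_Z=-\hat Q_{\mathbf Z}(\delta/4-\varepsilon)$ (this is $+\infty$ if $\varepsilon>\delta/4$) and $$A=\{Q_Z(\delta/4)\ge\hat Q_{\mathbf Z}(\delta/4-\varepsilon)\}$$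 where $Q_Z$ is the upper quantile function of the law of $Z$. Let $w_i=|c_Z|\,g_i$ for $m\le i\le M$ and $w_i=g^{\mathrm{tail}}_i$ for $i>M$, and define $$C_i=[\hat Q_i(\alpha/2-w_i),\ \hat Q_i^-(1-\alpha/2+w_i)],\qquad \overline C_i=[\hat Q_i^-(\alpha/2-w_i),\ \hat Q_i(1-\alpha/2+w_i)].$$ One has $C_i\subseteq\overline C_i$, with equality unless $i(\alpha/2-w_i)$ is an integer. **Claim.** 1. $\mathbb P(A)\ge 1-\tilde\delta$. 2. On $A$, $$\mathbb P\Big(\exists t\ge m:\ \hat F_t(Q(p))<p-\mathbb I_{t\le M}\,c_Z g_t-\mathbb I_{t>M}\,g^{\mathrm{tail}}_t\ \Big|\ \mathbf Z\Big)\le\frac\delta2 .$$ 3. On $A$, with conditional probability given $\mathbf Z$ at least $1-\delta$, the following holds simultaneously for all $i\ge m$: $F(\overline C_i)\ge 1-\alpha$, and also $F(C_i)\ge1-\alpha$ whenever $i>M$ or $i(\alpha/2-w_i)$ is not an integer. 4. Consequently the $(\tilde\delta,\delta,\alpha)$ guarantee holds: with probability at least $1-\tilde\delta$ over $\mathbf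 Z$, the event in part 3 has conditional probability given $\mathbf Z$ at least $1-\delta$. -/

import Mathlib

open MeasureTheory ProbabilityTheory

noncomputable section

namespace QuantilePAC

/-- Upper quantile function `Q(p) = sup {x : F x ≤ p}` of a function `F`, with values in the
extended reals (`sup ∅ = -∞`). The level is an extended real, so that it may be infinite. -/
def upperQuantile (F : ℝ → ℝ) (p : EReal) : EReal :=
  sSup {y : EReal | ∃ x : ℝ, y = (x : EReal) ∧ (F x : EReal) ≤ p}

/-- Lower quantile function `Q⁻(p) = sup {x : F x < p}`. -/
def lowerQuantile (F : ℝ → ℝ) (p : EReal) : EReal :=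
  sSup {y : EReal | ∃ x : ℝ, y = (x : EReal) ∧ (F x : EReal) < p}

/-- Empirical distribution function of a sample `x₁, …, xₙ`. -/
def empCDF {n : ℕ} (x : Fin n → ℝ) (y : ℝ) : ℝ :=
  (∑ i : Fin n, if x i ≤ y then (1 : ℝ) else 0) / n

/-- The (upper) `p`-quantile of a distribution on the real line as a real number; for a
probability measure and `0 < p < 1` the quantile is finite. -/
def realQuantile (ν : Measure ℝ) (p : ℝ) : ℝ :=
  (upperQuantile (cdf ν) (p : EReal)).toReal

/-- `ℓ(t) = s log log (η t / M) + log (2 ζ(s) / (δ (log η) ^ s))`. -/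
def logTerm (s η δ : ℝ) (M t : ℕ) : ℝ :=
  s * Real.log (Real.log (η * t / M))
    + Real.log (2 * (riemannZeta (s : ℂ)).re / (δ * (Real.log η) ^ s))

/-- The single-quantile boundary `g(t, M, p, δ)` of Howard and Ramdas, with parameters `s`, `η`,
on the scale of the empirical distribution function. -/
def boundary (s η p δ : ℝ) (M t : ℕ) : ℝ :=
  let l : ℝ := logTerm s η δ M t
  let k₁ : ℝ := (η ^ (1 / 4 : ℝ) + η ^ (-(1 / 4) : ℝ)) / Real.sqrt 2
  let k₂ : ℝ := (Real.sqrt η + 1) / 2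
  let c : ℝ := (1 - 2 * p) / 3
  (Real.sqrt (k₁ ^ 2 * (p * (1 - p)) * t * l + k₂ ^ 2 * c ^ 2 * l ^ 2) + c * k₂ * l) / t

/-- `S_t = ∑_{i ≤ t} (1{x_i ≤ Q_ν(p)} - p)`. -/
def quantileProcess (ν : Measure ℝ) (p : ℝ) (x : ℕ → ℝ) (t : ℕ) : ℝ :=
  ∑ i ∈ Finset.range t, ((if x i ≤ realQuantile ν p then (1 : ℝ) else 0) - p)

/-- The statistic `Z = min_{m ≤ t ≤ M} S_t / (t g_t)` of a path `x`. -/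
def minStat (ν : Measure ℝ) (p : ℝ) (g : ℕ → ℝ) {m M : ℕ} (h : m ≤ M) (x : ℕ → ℝ) : ℝ :=
  (Finset.Icc m M).inf' (Finset.nonempty_Icc.mpr h)
    (fun t => quantileProcess ν p x t / (t * g t))

/-- The law of `Z` when the path is an i.i.d. sequence with law `ν`. -/
def minStatLaw (ν : Measure ℝ) (p : ℝ) (g : ℕ → ℝ) {m M : ℕ} (h : m ≤ M) : Measure ℝ :=
  (Measure.infinitePi (fun _ : ℕ => ν)).map (minStat ν p g h)

/-- `h(u) = (1 + u) log (1 + u) - u`. -/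
def bennettH (u : ℝ) : ℝ := (1 + u) * Real.log (1 + u) - u

/-- The constant `c_Z = - Q̂_Z(q - ε)` computed from a simulated sample `z` of `Z`; it is `+∞`
when `q - ε < 0`. -/
def simConst {N : ℕ} (z : Fin N → ℝ) (q ε : ℝ) : EReal :=
  - upperQuantile (empCDF z) ((q - ε : ℝ) : EReal)

/-- The stitched width: `c g_t` for `t ≤ M`, and the analytic boundary `gTail t` for `t > M`. -/
def stitchedWidth (c : EReal) (g gTail : ℕ → ℝ) (M t : ℕ) : EReal :=
  if t ≤ M then c * (g t : EReal) else (gTail t : EReal)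

/-- `|c|` in the extended reals. -/
def eabs (c : EReal) : EReal := max c (-c)

/-- `[Q̂_n(α/2 - w), Q̂_n⁻(1 - α/2 + w)]`, as a set of real numbers. -/
def predInterval {n : ℕ} (x : Fin n → ℝ) (α : ℝ) (w : EReal) : Set ℝ :=
  {y : ℝ | upperQuantile (empCDF x) (((α / 2 : ℝ) : EReal) - w) ≤ (y : EReal) ∧
    (y : EReal) ≤ lowerQuantile (empCDF x) (((1 - α / 2 : ℝ) : EReal) + w)}

/-- `[Q̂_n⁻(α/2 - w), Q̂_n(1 - α/2 + w)]`: the same interval with the two versions of the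
empirical quantile exchanged. It contains `predInterval x α w` and is equal to it unless
`n (α/2 - w)` is an integer. -/
def predIntervalWide {n : ℕ} (x : Fin n → ℝ) (α : ℝ) (w : EReal) : Set ℝ :=
  {y : ℝ | lowerQuantile (empCDF x) (((α / 2 : ℝ) : EReal) - w) ≤ (y : EReal) ∧
    (y : EReal) ≤ upperQuantile (empCDF x) (((1 - α / 2 : ℝ) : EReal) + w)}

/-- The data event that, at every time `i ≥ m`, the prediction interval of width parameter `w i`
has coverage at least `1 - α` for a new observation with law `F`: the wide interval always, and
the narrow one beyond `M` and whenever `i (α/2 - w i)` is not an integer. -/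
def CoverageEvent (F : Measure ℝ) (α : ℝ) (m M : ℕ) (w : ℕ → EReal) (x : ℕ → ℝ) : Prop :=
  ∀ i : ℕ, m ≤ i →
    1 - α ≤ F.real (predIntervalWide (fun j : Fin i => x j) α (w i)) ∧
    ((M < i ∨ ∀ k : ℤ, (i : EReal) * (((α / 2 : ℝ) : EReal) - w i) ≠ ((k : ℝ) : EReal)) →
      1 - α ≤ F.real (predInterval (fun j : Fin i => x j) α (w i)))

end QuantilePAC

end

noncomputable section

namespace QuantilePAC

/-! Everything reduces to a one-sided question: how rarely can i.i.d. data hit a fixed set `S` of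
mass at least `p = α/2`? Let `z` be the true `δ/4`-quantile of the law of `Z`. On `A` the simulated
constant satisfies `c_Z ≥ -z`, and Bennett's inequality for the empirical distribution function of
the simulated sample shows that `A` is likely (`measure_upperQuantile_empCDF_le_compl_le`).

Along a path with law `ν`, a frequency of `(-∞, Q_ν(p)]` below `p + z g_t` at some `t ∈ [m, M]`
forces `Z < z`, an event of probability at most `δ/4`. After `M`, Ville's inequality stitched over
geometric epochs (`measure_hitCount_boundary_le`) costs another `δ/4`. Heavier sets are hit
stochastically more often, so `infinitePi_indicator_mono` carries the total `δ/2` from `ν` to the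
data and every `S` with `F(S) ≥ p`.

Apply this to `S = (-∞, Q(p)]` and `S = [Q(1-p), ∞)`. If neither is hit too rarely, the prediction
interval contains `[Q(p), Q(1-p)]`, which has mass at least `1 - α`. Simulation and data live on
separate probability spaces, so conditioning on the simulation means fixing `ω'`. -/

/-! ### Exponential moments of Bernoulli variables -/

/-- The trapezoidal rule overestimates the integral of the convex function `exp (-y)` over `[0, x]`.
-/
lemma one_sub_exp_neg_le {x : ℝ} (hx : 0 ≤ x) :
    1 - Real.exp (-x) ≤ x * (1 + Real.exp (-x)) / 2 := by
  have hd : ∀ y : ℝ, HasDerivAt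
      (fun y : ℝ => y * (1 + Real.exp (-y)) / 2 - (1 - Real.exp (-y)))
      ((1 - Real.exp (-y) - y * Real.exp (-y)) / 2) y := by
    intro y
    have he : HasDerivAt (fun y : ℝ => Real.exp (-y)) (-Real.exp (-y)) y := by
      simpa using (hasDerivAt_neg y).exp
    refine ((((hasDerivAt_id y).mul (he.const_add 1)).div_const 2).sub
      (he.const_sub 1)).congr_deriv ?_
    simp only [id]
    ring
  have hmono : Monotone (fun y : ℝ => y * (1 + Real.exp (-y)) / 2 - (1 - Real.exp (-y))) := by
    refine monotone_of_hasDerivAt_nonneg hd fun y => ?_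
    have h1 : (1 + y) * Real.exp (-y) ≤ 1 := by
      have := mul_le_mul_of_nonneg_right (Real.add_one_le_exp y) (Real.exp_pos (-y)).le
      rw [← Real.exp_add, add_neg_cancel, Real.exp_zero] at this
      linarith
    simp only [Pi.zero_apply]
    linarith
  have := hmono hx
  simp only [neg_zero, Real.exp_zero] at this
  linarith

/-- For `p ≤ 1/2` the lower tail is sub-Gaussian with the true variance `p (1 - p)`, so no
correction for skewness is needed later. -/
lemma bernoulli_mgf_neg_le_subgaussian {p l : ℝ} (hp0 : 0 ≤ p) (hp : p ≤ 1 / 2) (hl : 0 ≤ l) :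
    1 - p + p * Real.exp (-l) ≤ Real.exp (-(p * l) + p * (1 - p) * l ^ 2 / 2) := by
  have hpos : ∀ y : ℝ, 0 < 1 - p + p * Real.exp (-y) := fun y => by
    have := mul_nonneg hp0 (Real.exp_pos (-y)).le
    linarith
  have hd : ∀ y : ℝ, HasDerivAt
      (fun y : ℝ => p * (1 - p) * y ^ 2 / 2 - p * y - Real.log (1 - p + p * Real.exp (-y)))
      (p * (1 - p) * y - p + p * Real.exp (-y) / (1 - p + p * Real.exp (-y))) y := by
    intro y
    have he : HasDerivAt (fun y : ℝ => Real.exp (-y)) (-Real.exp (-y)) y := by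
      simpa using (hasDerivAt_neg y).exp
    have hlog := ((he.const_mul p).const_add (1 - p)).log (hpos y).ne'
    refine (((((hasDerivAt_id y).pow 2).const_mul (p * (1 - p))).div_const 2).sub
      ((hasDerivAt_id y).const_mul p)).sub hlog |>.congr_deriv ?_
    simp only [id]
    ring
  have hmono : MonotoneOn
      (fun y : ℝ => p * (1 - p) * y ^ 2 / 2 - p * y - Real.log (1 - p + p * Real.exp (-y)))
      (Set.Ici 0) := by
    refine monotoneOn_of_hasDerivWithinAt_nonneg (convex_Ici 0)
      (fun y _ => (hd y).continuousAt.continuousWithinAt)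
      (fun y _ => (hd y).hasDerivWithinAt) fun y hy => ?_
    rw [interior_Ici] at hy
    have hy0 : 0 ≤ y := le_of_lt hy
    have h1 := one_sub_exp_neg_le hy0
    have hx1 : Real.exp (-y) ≤ 1 := Real.exp_le_one_iff.mpr (by linarith)
    set x := Real.exp (-y)
    have hx : 0 < 1 - p + p * x := hpos y
    -- Since `p ≤ 1/2`, the average `1 - p + p x` of `1` and `x ≤ 1` is at least the midpoint `(1 +
    -- x) / 2`.
    have h2 : 1 - x ≤ y * (1 - p + p * x) := by
      nlinarith [mul_nonneg (mul_nonneg hy0 (by linarith : 0 ≤ 1 / 2 - p))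
        (by linarith : 0 ≤ 1 - x)]
    have h3 : p * (1 - p) * y - p + p * x / (1 - p + p * x)
        = p * (1 - p) * (y * (1 - p + p * x) - (1 - x)) / (1 - p + p * x) := by
      rw [eq_div_iff hx.ne', add_mul, div_mul_cancel₀ _ hx.ne']
      ring
    rw [h3]
    have : 0 ≤ 1 - p := by linarith
    have : 0 ≤ y * (1 - p + p * x) - (1 - x) := by linarith
    positivity
  have h := hmono (Set.mem_Ici.mpr le_rfl) (Set.mem_Ici.mpr hl) hl
  norm_num at h
  rw [← Real.log_le_iff_le_exp (hpos l)]
  linarith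

/-- After centring, compare derivatives in `l` to bound the moment generating function by `1 + q (1
- q) (exp l - 1 - l)`, then use `1 + x ≤ exp x`. -/
lemma bernoulli_mgf_neg_le_bennett {q l : ℝ} (hq0 : 0 ≤ q) (hq : q ≤ 1) (hl : 0 ≤ l) :
    1 - q + q * Real.exp (-l) ≤
      Real.exp (-(q * l) + q * (1 - q) * (Real.exp l - 1 - l)) := by
  have hd : ∀ y : ℝ, HasDerivAt
      (fun y : ℝ => 1 + q * (1 - q) * (Real.exp y - 1 - y)
        - ((1 - q) * Real.exp (q * y) + q * Real.exp (-((1 - q) * y))))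
      (q * (1 - q) * (Real.exp y - 1 - Real.exp (q * y) + Real.exp (-((1 - q) * y)))) y := by
    intro y
    have h1 : HasDerivAt (fun y : ℝ => Real.exp (q * y)) (Real.exp (q * y) * (q * 1)) y :=
      ((hasDerivAt_id y).const_mul q).exp
    have h2 : HasDerivAt (fun y : ℝ => Real.exp (-((1 - q) * y)))
        (Real.exp (-((1 - q) * y)) * -((1 - q) * 1)) y :=
      ((hasDerivAt_id y).const_mul (1 - q)).neg.exp
    refine (((((Real.hasDerivAt_exp y).sub_const 1).sub (hasDerivAt_id y)).const_mul
      (q * (1 - q))).const_add 1).sub ((h1.const_mul (1 - q)).add (h2.const_mul q))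
      |>.congr_deriv ?_
    ring
  have hmono : MonotoneOn (fun y : ℝ => 1 + q * (1 - q) * (Real.exp y - 1 - y)
        - ((1 - q) * Real.exp (q * y) + q * Real.exp (-((1 - q) * y)))) (Set.Ici 0) := by
    refine monotoneOn_of_hasDerivWithinAt_nonneg (convex_Ici 0)
      (fun y _ => (hd y).continuousAt.continuousWithinAt)
      (fun y _ => (hd y).hasDerivWithinAt) fun y hy => ?_
    rw [interior_Ici] at hy
    have hy0 : 0 ≤ y := le_of_lt hy
    have hq1 : 0 ≤ 1 - q := by linarith
    have key : Real.exp y - 1 - Real.exp (q * y) + Real.exp (-((1 - q) * y))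
        = (Real.exp ((1 - q) * y) - 1) * (Real.exp (q * y) - Real.exp (-((1 - q) * y))) := by
      have h1 : Real.exp ((1 - q) * y) * Real.exp (q * y) = Real.exp y := by
        rw [← Real.exp_add]; ring_nf
      have h2 : Real.exp ((1 - q) * y) * Real.exp (-((1 - q) * y)) = 1 := by
        rw [← Real.exp_add]; simp
      linear_combination -h1 + h2
    rw [key]
    have h1 : 0 ≤ Real.exp ((1 - q) * y) - 1 :=
      sub_nonneg.mpr (Real.one_le_exp (by positivity))
    have h2 : 0 ≤ Real.exp (q * y) - Real.exp (-((1 - q) * y)) := by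
      rw [sub_nonneg, Real.exp_le_exp]
      linarith
    positivity
  have h := hmono (Set.mem_Ici.mpr le_rfl) (Set.mem_Ici.mpr hl) hl
  norm_num at h
  have h2 := Real.add_one_le_exp (q * (1 - q) * (Real.exp l - 1 - l))
  have h3 : (1 - q) * Real.exp (q * l) + q * Real.exp (-((1 - q) * l))
      = Real.exp (q * l) * (1 - q + q * Real.exp (-l)) := by
    rw [mul_add, mul_left_comm (Real.exp _) q, ← Real.exp_add]
    ring_nf
  rw [Real.exp_add, Real.exp_neg (q * l), inv_mul_eq_div,
    le_div_iff₀ (Real.exp_pos _), mul_comm, ← h3]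
  linarith

lemma bennettH_exponent {v ε : ℝ} (hv : 0 < v) (hε : 0 < ε) :
    -(Real.log (1 + ε / v) * ε) +
      v * (Real.exp (Real.log (1 + ε / v)) - 1 - Real.log (1 + ε / v)) =
      -(v * bennettH (ε / v)) := by
  have : 0 < 1 + ε / v := by positivity
  rw [Real.exp_log this, bennettH]
  have : ε = v * (ε / v) := by field_simp
  generalize ε / v = u at *
  subst this
  ring

/-! ### Ville's inequality and linear boundaries -/

/-- Ville's inequality for the martingale of partial products of independent nonnegative bounded
random variables with mean one. -/
lemma ville_prod {Ω : Type*} [MeasurableSpace Ω] {μ : Measure Ω} [IsProbabilityMeasure μ]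
    {Y : ℕ → Ω → ℝ} (hY : ∀ i, Measurable (Y i)) (hind : iIndepFun Y μ)
    (h0 : ∀ i ω, 0 ≤ Y i ω) {C : ℝ} (hC : ∀ i ω, Y i ω ≤ C) (h1 : ∀ i, ∫ ω, Y i ω ∂μ = 1)
    {a : ℝ} (ha : 0 < a) :
    μ {ω | ∃ n, a ≤ ∏ i ∈ Finset.range (n + 1), Y i ω} ≤ ENNReal.ofReal (1 / a) := by
  have hsm : ∀ i, StronglyMeasurable (Y i) := fun i => (hY i).stronglyMeasurable
  let 𝒢 := Filtration.natural Y hsm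
  let f : ℕ → Ω → ℝ := fun n ω => ∏ i ∈ Finset.range (n + 1), Y i ω
  have hf0 : ∀ n ω, 0 ≤ f n ω := fun n ω => Finset.prod_nonneg fun i _ => h0 i ω
  have hYi : ∀ i, Integrable (Y i) μ := fun i =>
    Integrable.of_bound (hY i).aestronglyMeasurable C
      (ae_of_all _ fun ω => by rw [Real.norm_of_nonneg (h0 i ω)]; exact hC i ω)
  have hfm : ∀ n, Measurable (f n) := fun n => Finset.measurable_fun_prod _ fun i _ => hY i
  have hfi : ∀ n, Integrable (f n) μ := fun n =>
    Integrable.of_bound (hfm n).aestronglyMeasurable (C ^ (n + 1)) (ae_of_all _ fun ω => by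
      rw [Real.norm_of_nonneg (hf0 n ω)]
      refine (Finset.prod_le_prod (fun i _ => h0 i ω) fun i _ => hC i ω).trans ?_
      simp)
  have hadp : StronglyAdapted 𝒢 f := fun n => by
    refine Finset.stronglyMeasurable_fun_prod _ fun i hi => ?_
    exact (Filtration.stronglyAdapted_natural hsm i).mono
      (𝒢.mono (Nat.lt_succ_iff.mp (Finset.mem_range.mp hi)))
  have hsucc : ∀ n, f (n + 1) = f n * Y (n + 1) := fun n => by
    ext ω
    exact Finset.prod_range_succ _ _
  have hmart : Martingale f 𝒢 μ := by
    refine martingale_nat hadp hfi fun n => ?_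
    have h2 := condExp_mul_of_stronglyMeasurable_left (hadp n)
      (by rw [← hsucc]; exact hfi (n + 1)) (hYi (n + 1)) (μ := μ)
    have h3 := hind.condExp_natural_ae_eq_of_lt hsm (Nat.lt_succ_self n)
    rw [hsucc]
    filter_upwards [h2, h3] with ω h2 h3
    rw [h2, Pi.mul_apply, h3, h1, mul_one]
  have hint : ∀ n, ∫ ω, f n ω ∂μ = 1 := fun n => by
    have : ∫ ω, f n ω ∂μ = ∫ ω, f 0 ω ∂μ := by
      simpa using (hmart.setIntegral_eq (Nat.zero_le n) MeasurableSet.univ).symm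
    rw [this]
    simpa [f] using h1 0
  let E : ℕ → Set Ω := fun n => {ω | ((⟨a, ha.le⟩ : NNReal) : ℝ) ≤
    (Finset.range (n + 1)).sup' Finset.nonempty_range_add_one fun k => f k ω}
  have hE : ∀ n, μ (E n) ≤ ENNReal.ofReal (1 / a) := fun n => by
    have h := (maximal_ineq hmart.submartingale (fun n ω => hf0 n ω) (ε := ⟨a, ha.le⟩) n).trans
      (ENNReal.ofReal_le_ofReal (setIntegral_le_integral (hfi n) (ae_of_all _ (hf0 n))))
    rw [hint, ENNReal.ofReal_one] at h
    rw [one_div, ENNReal.ofReal_inv_of_pos ha, ENNReal.le_inv_iff_mul_le, mul_comm]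
    rwa [ENNReal.ofReal_eq_coe_nnreal ha.le]
  have hEm : Monotone E := fun n k hnk ω hω => by
    simp only [E, Set.mem_ofPred_eq, Finset.le_sup'_iff] at hω ⊢
    obtain ⟨i, hi, h⟩ := hω
    exact ⟨i, Finset.range_mono (by omega) hi, h⟩
  have hsub : {ω | ∃ n, a ≤ ∏ i ∈ Finset.range (n + 1), Y i ω} ⊆ ⋃ n, E n := by
    rintro ω ⟨n, hn⟩
    refine Set.mem_iUnion.mpr ⟨n, ?_⟩
    simp only [E, Set.mem_ofPred_eq, Finset.le_sup'_iff]
    exact ⟨n, Finset.self_mem_range_succ n, hn⟩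
  refine (measure_mono hsub).trans ?_
  rw [hEm.measure_iUnion]
  exact iSup_le hE

/-- The count `∑_{i < t} 1{x_i ∈ S}`. -/
def hitCount (S : Set ℝ) (x : ℕ → ℝ) (t : ℕ) : ℝ :=
  ∑ i ∈ Finset.range t, S.indicator (fun _ => (1 : ℝ)) (x i)

lemma integral_exp_mul_indicator {Ω : Type*} [MeasurableSpace Ω] (μ : Measure Ω)
    [IsProbabilityMeasure μ] {S : Set Ω} (hS : MeasurableSet S) (l : ℝ) :
    ∫ x, Real.exp (l * S.indicator (fun _ => (1 : ℝ)) x) ∂μ =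
      1 - μ.real S + μ.real S * Real.exp l := by
  have h : (fun x => Real.exp (l * S.indicator (fun _ => (1 : ℝ)) x))
      = fun x => 1 + S.indicator (fun _ => Real.exp l - 1) x := by
    ext x
    by_cases hx : x ∈ S <;> simp [hx]
  rw [h, integral_add (integrable_const _) ((integrable_const _).indicator hS),
    integral_indicator hS]
  simp
  ring

/-- The normalised exponentials of `-l` times the indicators have mean one. Crossing the line forces
their product above `exp L`, because the sub-Gaussian bound controls the normaliser `G ^ t`. -/
lemma measure_hitCount_line_le (ν : Measure ℝ) [IsProbabilityMeasure ν] {S : Set ℝ}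
    (hS : MeasurableSet S) {p : ℝ} (hp : ν.real S = p) (hp2 : p ≤ 1 / 2) {l L : ℝ} (hl : 0 < l) :
    Measure.infinitePi (fun _ : ℕ => ν) {x | ∃ t : ℕ, 1 ≤ t ∧
      L / l + l * (p * (1 - p)) * t / 2 ≤ p * t - hitCount S x t} ≤
      ENNReal.ofReal (Real.exp (-L)) := by
  have hp0 : 0 ≤ p := hp ▸ measureReal_nonneg
  set G := 1 - p + p * Real.exp (-l)
  have hG : 0 < G := by
    have := mul_nonneg hp0 (Real.exp_pos (-l)).le
    simp only [G]
    linarith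
  let y : ℝ → ℝ := fun z => Real.exp (-l * S.indicator (fun _ => (1 : ℝ)) z) / G
  have hy : Measurable y := by
    have : Measurable (S.indicator (fun _ => (1 : ℝ))) := measurable_const.indicator hS
    fun_prop
  have hy1 : ∫ z, y z ∂ν = 1 := by
    simp only [y]
    rw [integral_div, integral_exp_mul_indicator ν hS, hp, div_self hG.ne']
  have hyC : ∀ z, y z ≤ 1 / G := fun z => by
    refine div_le_div_of_nonneg_right (Real.exp_le_one_iff.mpr ?_) hG.le
    have : 0 ≤ S.indicator (fun _ => (1 : ℝ)) z := Set.indicator_nonneg (by simp) z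
    nlinarith
  have hv := ville_prod (μ := Measure.infinitePi (fun _ : ℕ => ν)) (Y := fun i x => y (x i))
    (fun i => hy.comp (measurable_pi_apply i)) (iIndepFun_infinitePi fun _ => hy)
    (fun i x => by positivity) (fun i x => hyC _)
    (fun i => by
      have h := integral_map (μ := Measure.infinitePi fun _ : ℕ => ν)
        (measurable_pi_apply i).aemeasurable (f := y) hy.aestronglyMeasurable
      rw [Measure.infinitePi_map_eval] at h
      exact h.symm.trans hy1)
    (Real.exp_pos L)
  rw [one_div, ← Real.exp_neg] at hv
  refine (measure_mono ?_).trans hv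
  rintro x ⟨t, ht, hx⟩
  refine ⟨t - 1, ?_⟩
  rw [Nat.sub_add_cancel ht]
  have hprod : ∏ i ∈ Finset.range t, y (x i) = Real.exp (-l * hitCount S x t) / G ^ t := by
    simp only [y, Finset.prod_div_distrib, Finset.prod_const, Finset.card_range, hitCount,
      Finset.mul_sum, Real.exp_sum]
  rw [hprod, le_div_iff₀ (by positivity)]
  have hGt : G ^ t ≤ Real.exp ((-(p * l) + p * (1 - p) * l ^ 2 / 2) * t) := by
    rw [mul_comm, Real.exp_nat_mul]
    exact pow_le_pow_left₀ hG.le (bernoulli_mgf_neg_le_subgaussian hp0 hp2 hl.le) t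
  refine (mul_le_mul_of_nonneg_left hGt (Real.exp_pos L).le).trans ?_
  rw [← Real.exp_add, Real.exp_le_exp]
  have := mul_le_mul_of_nonneg_left hx hl.le
  rw [mul_add, mul_div_cancel₀ _ hl.ne'] at this
  linarith

/-! ### The stitched boundary -/

lemma zeta_re_eq_tsum {s : ℝ} (hs : 1 < s) :
    (riemannZeta (s : ℂ)).re = ∑' n : ℕ, 1 / ((n : ℝ) + 1) ^ s := by
  rw [zeta_eq_tsum_one_div_nat_add_one_cpow (by simpa using hs)]
  have : ∀ n : ℕ, 1 / ((n : ℂ) + 1) ^ (s : ℂ) = ((1 / ((n : ℝ) + 1) ^ s : ℝ) : ℂ) := fun n => by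
    rw [Complex.ofReal_div, Complex.ofReal_cpow (by positivity)]
    simp
  simp_rw [this]
  rw [← Complex.ofReal_tsum, Complex.ofReal_re]

lemma summable_one_div_add_one_rpow {s : ℝ} (hs : 1 < s) :
    Summable fun n : ℕ => 1 / ((n : ℝ) + 1) ^ s := by
  have := (summable_nat_add_iff 1).mpr (Real.summable_one_div_nat_rpow.mpr hs)
  simpa using this

lemma one_le_zeta_re {s : ℝ} (hs : 1 < s) : 1 ≤ (riemannZeta (s : ℂ)).re := by
  rw [zeta_re_eq_tsum hs]
  have := (summable_one_div_add_one_rpow hs).le_tsum 0 fun n _ => by positivity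
  simpa using this

/-- In the variable `u = log_η (t / M)`, whose integer part numbers the epoch, the iterated
logarithm becomes `log (1 + u)`. -/
lemma logTerm_eq {s η δ : ℝ} (hs : 1 < s) (hη : 1 < η) (hδ : 0 < δ) {M t : ℕ} (hM : 1 ≤ M)
    (hMt : M ≤ t) :
    logTerm s η δ M t = Real.log (2 * (riemannZeta (s : ℂ)).re / δ)
      + s * Real.log (1 + Real.log (t / M) / Real.log η) := by
  have hz := one_le_zeta_re hs
  have hlη := Real.log_pos hη
  have hM' : (1 : ℝ) ≤ M := by exact_mod_cast hM
  have hMt' : (M : ℝ) ≤ t := by exact_mod_cast hMt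
  have hr : 1 ≤ (t : ℝ) / M := (one_le_div (by linarith)).mpr hMt'
  have hlr := Real.log_nonneg hr
  have h1 : Real.log (η * t / M) = Real.log η * (1 + Real.log (t / M) / Real.log η) := by
    rw [mul_div_assoc, Real.log_mul (by linarith) (by linarith)]
    field_simp
  have h2 : 0 < 1 + Real.log (t / M) / Real.log η := by positivity
  rw [logTerm, h1, Real.log_mul hlη.ne' h2.ne', ← div_div,
    Real.log_div (div_ne_zero (by positivity) hδ.ne') (by positivity), Real.log_rpow hlη]
  ring

lemma logTerm_pos {s η δ : ℝ} (hs : 1 < s) (hη : 1 < η) (hδ : 0 < δ) (hδ1 : δ < 1) {M t : ℕ}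
    (hM : 1 ≤ M) (hMt : M ≤ t) : 0 < logTerm s η δ M t := by
  rw [logTerm_eq hs hη hδ hM hMt]
  have hz := one_le_zeta_re hs
  have hM' : (1 : ℝ) ≤ M := by exact_mod_cast hM
  have hMt' : (M : ℝ) ≤ t := by exact_mod_cast hMt
  have hlr := Real.log_nonneg ((one_le_div (by linarith)).mpr hMt')
  have hlη := Real.log_pos hη
  have h1 : 0 < Real.log (2 * (riemannZeta (s : ℂ)).re / δ) :=
    Real.log_pos (by rw [lt_div_iff₀ hδ]; linarith)
  have h2 : 0 ≤ Real.log (1 + Real.log (t / M) / Real.log η) :=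
    Real.log_nonneg (by simpa using div_nonneg hlr hlη.le)
  positivity

/-- The terms with `c_p` and `k₂` only enlarge the boundary when `p ≤ 1/2`; the sub-Gaussian part
alone suffices. -/
lemma le_mul_boundary {s η p δ : ℝ} (hp : p ≤ 1 / 2) {M t : ℕ} (ht : 1 ≤ t)
    (hl : 0 ≤ logTerm s η δ M t) :
    (η ^ (1 / 4 : ℝ) + η ^ (-(1 / 4) : ℝ)) / Real.sqrt 2 *
      Real.sqrt (p * (1 - p) * t * logTerm s η δ M t) ≤ t * boundary s η p δ M t := by
  have ht' : (0 : ℝ) < t := by exact_mod_cast ht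
  simp only [boundary]
  rw [mul_div_cancel₀ _ ht'.ne']
  set l := logTerm s η δ M t
  set k := (η ^ (1 / 4 : ℝ) + η ^ (-(1 / 4) : ℝ)) / Real.sqrt 2
  have h1 : k * Real.sqrt (p * (1 - p) * t * l) ≤
      Real.sqrt (k ^ 2 * (p * (1 - p)) * t * l
        + ((Real.sqrt η + 1) / 2) ^ 2 * ((1 - 2 * p) / 3) ^ 2 * l ^ 2) := by
    calc k * Real.sqrt (p * (1 - p) * t * l) ≤ |k| * Real.sqrt (p * (1 - p) * t * l) :=
          mul_le_mul_of_nonneg_right (le_abs_self k) (Real.sqrt_nonneg _)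
      _ = Real.sqrt (k ^ 2 * (p * (1 - p) * t * l)) := by
          rw [Real.sqrt_mul (sq_nonneg k), Real.sqrt_sq_eq_abs]
      _ ≤ _ := Real.sqrt_le_sqrt (by
          have : 0 ≤ ((Real.sqrt η + 1) / 2) ^ 2 * ((1 - 2 * p) / 3) ^ 2 * l ^ 2 := by positivity
          linarith)
  have h2 : 0 ≤ (1 - 2 * p) / 3 * ((Real.sqrt η + 1) / 2) * l := by
    have : 0 ≤ 1 - 2 * p := by linarith
    positivity
  linarith

lemma boundary_pos {s η p δ : ℝ} (hs : 1 < s) (hη : 1 < η) (hδ : 0 < δ) (hδ1 : δ < 1)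
    (hp0 : 0 < p) (hp : p ≤ 1 / 2) {M t : ℕ} (hM : 1 ≤ M) (hMt : M ≤ t) :
    0 < boundary s η p δ M t := by
  have hl := logTerm_pos hs hη hδ hδ1 hM hMt
  have ht' : (0 : ℝ) < t := by exact_mod_cast (hM.trans hMt)
  have h1 : 0 < 1 - p := by linarith
  have h := le_mul_boundary (s := s) (η := η) (δ := δ) hp (hM.trans hMt) hl.le
  refine pos_of_mul_pos_right (lt_of_lt_of_le ?_ h) ht'.le
  positivity

/-- The line tangent at the geometric centre of an epoch stays below the curved boundary on the
whole epoch. -/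
lemma line_le_sqrt {V L c t w A : ℝ} (hV : 0 < V) (hL : 0 < L) (ht : 0 < t) (hw : 0 < w)
    (hc : c = t * w ^ 2) (hA : 0 < A) (hwA : w ≤ A) (hAw : 1 ≤ A * w) :
    L / Real.sqrt (2 * L / (V * c)) + Real.sqrt (2 * L / (V * c)) * V * t / 2 ≤
      (A + A⁻¹) / Real.sqrt 2 * Real.sqrt (V * t * L) := by
  have hσ : 0 < Real.sqrt 2 := by positivity
  have hσ2 : Real.sqrt 2 ^ 2 = 2 := Real.sq_sqrt (by norm_num)
  set σ := Real.sqrt 2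
  have hR : 0 < Real.sqrt (V * t * L) := by positivity
  have hR2 : Real.sqrt (V * t * L) ^ 2 = V * t * L := Real.sq_sqrt (by positivity)
  set R := Real.sqrt (V * t * L)
  -- With `w = √(c/t)`, the line at `t` equals `(w + w⁻¹) / √2 · √(V t L)`. It remains to see that
  -- `w + w⁻¹` is largest at the ends of `[A⁻¹, A]`.
  have hl : Real.sqrt (2 * L / (V * c)) = σ * L / (R * w) := by
    rw [Real.sqrt_eq_iff_mul_self_eq (by rw [hc]; positivity) (by positivity), hc]
    field_simp
    rw [hσ2, hR2]
    ring
  have h1 : L / (σ * L / (R * w)) = w / σ * R := by field_simp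
  have h2 : σ * L / (R * w) * V * t / 2 = w⁻¹ / σ * R := by
    field_simp
    rw [hσ2, hR2]
    ring
  rw [hl, h1, h2, ← add_mul, ← add_div]
  refine mul_le_mul_of_nonneg_right (div_le_div_of_nonneg_right ?_ hσ.le) hR.le
  have : A + A⁻¹ - (w + w⁻¹) = (A - w) * (A * w - 1) / (A * w) := by
    field_simp
    ring
  have h3 : 0 ≤ (A - w) * (A * w - 1) / (A * w) :=
    div_nonneg (mul_nonneg (by linarith) (by linarith)) (by positivity)
  linarith

/-- The stitched time-uniform lower bound for the frequency of a set of probability `p ≤ 1/2`. -/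
lemma measure_hitCount_boundary_le (ν : Measure ℝ) [IsProbabilityMeasure ν] {S : Set ℝ}
    (hS : MeasurableSet S) {p : ℝ} (hp : ν.real S = p) (hp0 : 0 < p) (hp2 : p ≤ 1 / 2)
    {s η δ : ℝ} (hs : 1 < s) (hη : 1 < η) (hδ : 0 < δ) (hδ1 : δ < 1) {M : ℕ} (hM : 1 ≤ M) :
    Measure.infinitePi (fun _ : ℕ => ν) {x | ∃ t : ℕ, M ≤ t ∧
      hitCount S x t ≤ t * (p - boundary s η p δ M t)} ≤ ENNReal.ofReal δ := by
  set ζ := (riemannZeta (s : ℂ)).re with hζ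
  have hz : 1 ≤ ζ := one_le_zeta_re hs
  have hV : 0 < p * (1 - p) := mul_pos hp0 (by linarith)
  have hM' : (0 : ℝ) < M := by exact_mod_cast hM
  have hlη := Real.log_pos hη
  -- Epoch `k` receives the error `exp (-L k) = δ / (2 ζ(s) (k + 1)^s)`; these sum to `δ / 2`.
  let L : ℕ → ℝ := fun k => Real.log (2 * ζ / δ) + s * Real.log (k + 1)
  have hL : ∀ k, 0 < L k := fun k => by
    have h1 : 0 < Real.log (2 * ζ / δ) := Real.log_pos (by rw [lt_div_iff₀ hδ]; linarith)
    have h2 : 0 ≤ Real.log ((k : ℝ) + 1) := Real.log_nonneg (by linarith [k.cast_nonneg (α := ℝ)])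
    simp only [L]
    positivity
  have hexp : ∀ k, Real.exp (-L k) = δ / (2 * ζ) * (1 / ((k : ℝ) + 1) ^ s) := fun k => by
    have hk : (0 : ℝ) < k + 1 := by positivity
    simp only [L]
    rw [neg_add, Real.exp_add, Real.exp_neg, Real.exp_log (by positivity), Real.exp_neg,
      mul_comm s, ← Real.rpow_def_of_pos hk, inv_div, one_div]
  -- Geometric centre of the epoch `[M η^k, M η^(k+1))`; `l k` makes the line tangent there.
  let c : ℕ → ℝ := fun k => M * η ^ ((k : ℝ) + 1 / 2)
  let l : ℕ → ℝ := fun k => Real.sqrt (2 * L k / (p * (1 - p) * c k))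
  have hc : ∀ k, 0 < c k := fun k => by positivity
  have hl : ∀ k, 0 < l k := fun k => by
    have := hL k
    have := hc k
    positivity
  have hsub : {x | ∃ t : ℕ, M ≤ t ∧ hitCount S x t ≤ t * (p - boundary s η p δ M t)} ⊆
      ⋃ k, {x | ∃ t : ℕ, 1 ≤ t ∧
        L k / l k + l k * (p * (1 - p)) * t / 2 ≤ p * t - hitCount S x t} := by
    rintro x ⟨t, hMt, hx⟩
    have ht : 1 ≤ t := hM.trans hMt
    have ht' : (0 : ℝ) < t := by exact_mod_cast ht
    have hr : 1 ≤ (t : ℝ) / M := (one_le_div hM').mpr (by exact_mod_cast hMt)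
    set u := Real.log (t / M) / Real.log η with hu
    have hu0 : 0 ≤ u := div_nonneg (Real.log_nonneg hr) hlη.le
    set k := ⌊u⌋₊ with hk
    have hk1 : (k : ℝ) ≤ u := Nat.floor_le hu0
    have hk2 : u < k + 1 := Nat.lt_floor_add_one u
    have htu : (t : ℝ) = M * η ^ u := by
      rw [Real.rpow_def_of_pos (by linarith), hu, mul_div_cancel₀ _ hlη.ne',
        Real.exp_log (by linarith), mul_div_cancel₀ _ hM'.ne']
    refine Set.mem_iUnion.mpr ⟨k, t, ht, ?_⟩
    have hLl : L k ≤ logTerm s η δ M t := by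
      rw [logTerm_eq hs hη hδ hM hMt]
      have : Real.log ((k : ℝ) + 1) ≤ Real.log (1 + u) :=
        Real.log_le_log (by positivity) (by linarith)
      have := mul_le_mul_of_nonneg_left this (by linarith : 0 ≤ s)
      simp only [L, ← hζ, ← hu]
      linarith
    have hη0 : 0 < η := by linarith
    -- Within an epoch `|k + 1/2 - u| ≤ 1/2`, so `w` lies between `η^(-1/4)` and `η^(1/4)`; this
    -- produces the constant `k₁`.
    have hline := line_le_sqrt (V := p * (1 - p)) (L := L k) (c := c k) (t := t)
      (w := η ^ (((k : ℝ) + 1 / 2 - u) / 2)) (A := η ^ (1 / 4 : ℝ)) hV (hL k) ht' (by positivity)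
      (by
        rw [htu, ← Real.rpow_natCast (η ^ _), ← Real.rpow_mul hη0.le, mul_assoc,
          ← Real.rpow_add hη0]
        simp only [c]
        congr 2
        push_cast
        ring)
      (by positivity)
      (Real.rpow_le_rpow_of_exponent_le hη.le (by linarith))
      (by
        rw [← Real.rpow_add hη0]
        exact Real.one_le_rpow hη.le (by linarith))
    rw [← Real.rpow_neg hη0.le] at hline
    have hb := le_mul_boundary (s := s) (η := η) (δ := δ) hp2 ht
      (logTerm_pos hs hη hδ hδ1 hM hMt).le
    have hsq : Real.sqrt (p * (1 - p) * t * L k) ≤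
        Real.sqrt (p * (1 - p) * t * logTerm s η δ M t) :=
      Real.sqrt_le_sqrt (mul_le_mul_of_nonneg_left hLl (by positivity))
    have hb2 := mul_le_mul_of_nonneg_left hsq
      (by positivity : 0 ≤ (η ^ (1 / 4 : ℝ) + η ^ (-(1 / 4) : ℝ)) / Real.sqrt 2)
    simp only [l]
    linarith
  refine (measure_mono hsub).trans ((measure_iUnion_le _).trans ?_)
  refine (ENNReal.tsum_le_tsum fun k => measure_hitCount_line_le ν hS hp hp2 (hl k)).trans ?_
  simp_rw [hexp]
  rw [← ENNReal.ofReal_tsum_of_nonneg (fun k => by positivity)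
    ((summable_one_div_add_one_rpow hs).mul_left _), tsum_mul_left, ← zeta_re_eq_tsum hs, ← hζ]
  refine ENNReal.ofReal_le_ofReal ?_
  rw [div_mul_eq_mul_div, div_le_iff₀ (by positivity)]
  nlinarith

/-! ### Stochastic monotonicity of independent trials -/

lemma map_indicator_eq {Ω Ω' : Type*} [MeasurableSpace Ω] [MeasurableSpace Ω']
    (μ : Measure Ω) [IsProbabilityMeasure μ] (μ' : Measure Ω') [IsProbabilityMeasure μ']
    {S : Set Ω} {S' : Set Ω'} (hS : MeasurableSet S) (hS' : MeasurableSet S')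
    (h : μ S = μ' S') :
    μ.map (S.indicator fun _ => (1 : ℝ)) = μ'.map (S'.indicator fun _ => (1 : ℝ)) := by
  have hc : μ Sᶜ = μ' S'ᶜ := by
    rw [prob_compl_eq_one_sub hS, prob_compl_eq_one_sub hS', h]
  ext T hT
  rw [Measure.map_apply (measurable_const.indicator hS) hT,
    Measure.map_apply (measurable_const.indicator hS') hT]
  classical
  rw [Set.indicator_const_preimage_eq_union, Set.indicator_const_preimage_eq_union]
  by_cases h1 : (1 : ℝ) ∈ T <;> by_cases h0 : (0 : ℝ) ∈ T <;> simp [h1, h0, h, hc]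

/-- The law of the indicator sequence depends only on the mass of the set, so both sequences can be
realised as `1{U_i ≤ r}` and `1{U_i ≤ r'}` with the same uniform variables. Then `r' ≤ r` orders
them pointwise. -/
lemma infinitePi_indicator_mono (μ μ' : Measure ℝ) [IsProbabilityMeasure μ]
    [IsProbabilityMeasure μ'] {S S' : Set ℝ} (hS : MeasurableSet S) (hS' : MeasurableSet S')
    (h : μ' S' ≤ μ S) {E : Set (ℕ → ℝ)} (hE : MeasurableSet E) (hlow : IsLowerSet E) :
    Measure.infinitePi (fun _ : ℕ => μ) {x | (fun i => S.indicator (fun _ => (1 : ℝ)) (x i)) ∈ E} ≤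
      Measure.infinitePi (fun _ : ℕ => μ')
        {x | (fun i => S'.indicator (fun _ => (1 : ℝ)) (x i)) ∈ E} := by
  have key : ∀ (κ : Measure ℝ) [IsProbabilityMeasure κ] (T : Set ℝ) (_ : MeasurableSet T),
      ∃ r : unitInterval, ENNReal.ofReal r = κ T ∧
      Measure.infinitePi (fun _ : ℕ => κ)
          {x | (fun i => T.indicator (fun _ => (1 : ℝ)) (x i)) ∈ E} =
        Measure.infinitePi (fun _ : ℕ => (volume : Measure unitInterval))
          {x | (fun i => (Set.Iic r).indicator (fun _ => (1 : ℝ)) (x i)) ∈ E} := by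
    intro κ _ T hT
    refine ⟨⟨κ.real T, measureReal_nonneg, measureReal_le_one⟩, ofReal_measureReal, ?_⟩
    set r : unitInterval := ⟨κ.real T, measureReal_nonneg, measureReal_le_one⟩
    have h1 : Measurable (T.indicator fun _ => (1 : ℝ)) := measurable_const.indicator hT
    have h2 : Measurable ((Set.Iic r).indicator fun _ => (1 : ℝ)) :=
      measurable_const.indicator measurableSet_Iic
    have e1 := Measure.infinitePi_map_pi (fun _ : ℕ => κ) (fun _ => h1)
    have e2 := Measure.infinitePi_map_pi (fun _ : ℕ => (volume : Measure unitInterval))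
      (fun _ => h2)
    have e3 : κ.map (T.indicator fun _ => (1 : ℝ)) =
        (volume : Measure unitInterval).map ((Set.Iic r).indicator fun _ => (1 : ℝ)) :=
      map_indicator_eq _ _ hT measurableSet_Iic
        (by rw [unitInterval.volume_Iic]; exact (ofReal_measureReal (μ := κ) (s := T)).symm)
    have e4 := congrArg (fun m => m E) (e1.trans ((by simp_rw [e3] : _ = _).trans e2.symm))
    rwa [Measure.map_apply (by fun_prop) hE, Measure.map_apply (by fun_prop) hE] at e4
  obtain ⟨r, hr, e⟩ := key μ S hS
  obtain ⟨r', hr', e'⟩ := key μ' S' hS'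
  rw [e, e']
  refine measure_mono fun x hx => hlow ?_ hx
  intro i
  refine Set.indicator_le_indicator_of_subset (Set.Iic_subset_Iic.mpr ?_) (fun _ => zero_le_one) _
  rw [← hr, ← hr'] at h
  exact (ENNReal.ofReal_le_ofReal_iff r.2.1).mp h

/-! ### Quantiles of a probability measure on the line -/

lemma coe_realQuantile (μ : Measure ℝ) {p : ℝ} (hp0 : 0 < p) (hp1 : p < 1) :
    ((realQuantile μ p : ℝ) : EReal) = upperQuantile (cdf μ) (p : EReal) := by
  refine EReal.coe_toReal ?_ ?_
  · obtain ⟨B, hB⟩ := ((tendsto_cdf_atTop μ).eventually_const_lt hp1).exists_forall_of_atTop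
    refine ne_top_of_le_ne_top (EReal.coe_ne_top B) (sSup_le ?_)
    rintro _ ⟨x, rfl, hx⟩
    rw [EReal.coe_le_coe_iff] at hx ⊢
    by_contra! hBx
    exact absurd (hB x hBx.le) (not_lt.mpr hx)
  · obtain ⟨B, hB⟩ := ((tendsto_cdf_atBot μ).eventually_lt_const hp0).exists
    refine ne_bot_of_le_ne_bot (EReal.coe_ne_bot B) (le_sSup ⟨B, rfl, ?_⟩)
    exact EReal.coe_le_coe_iff.mpr hB.le

lemma lt_cdf_of_realQuantile_lt (μ : Measure ℝ) {p : ℝ} (hp0 : 0 < p) (hp1 : p < 1) {y : ℝ}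
    (hy : realQuantile μ p < y) : p < cdf μ y := by
  by_contra! h
  have : (y : EReal) ≤ upperQuantile (cdf μ) (p : EReal) :=
    le_sSup ⟨y, rfl, EReal.coe_le_coe_iff.mpr h⟩
  rw [← coe_realQuantile μ hp0 hp1, EReal.coe_le_coe_iff] at this
  linarith

lemma cdf_le_of_lt_realQuantile (μ : Measure ℝ) {p : ℝ} (hp0 : 0 < p) (hp1 : p < 1) {y : ℝ}
    (hy : y < realQuantile μ p) : cdf μ y ≤ p := by
  have h : (y : EReal) < upperQuantile (cdf μ) (p : EReal) := by
    rw [← coe_realQuantile μ hp0 hp1]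
    exact EReal.coe_lt_coe_iff.mpr hy
  obtain ⟨_, ⟨x, rfl, hx⟩, hyx⟩ := lt_sSup_iff.mp h
  exact (monotone_cdf μ (EReal.coe_lt_coe_iff.mp hyx).le).trans (EReal.coe_le_coe_iff.mp hx)

lemma le_measureReal_Iic_realQuantile (μ : Measure ℝ) [IsProbabilityMeasure μ] {p : ℝ}
    (hp0 : 0 < p) (hp1 : p < 1) : p ≤ μ.real (Set.Iic (realQuantile μ p)) := by
  rw [← cdf_eq_real]
  have hc : Filter.Tendsto (cdf μ) (nhdsWithin (realQuantile μ p) (Set.Ioi (realQuantile μ p)))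
      (nhds (cdf μ (realQuantile μ p))) :=
    ((cdf μ).right_continuous _).tendsto.mono_left (nhdsWithin_mono _ Set.Ioi_subset_Ici_self)
  refine ge_of_tendsto hc ?_
  filter_upwards [self_mem_nhdsWithin] with y hy
  exact (lt_cdf_of_realQuantile_lt μ hp0 hp1 hy).le

lemma measureReal_Iio_realQuantile_le (μ : Measure ℝ) [IsProbabilityMeasure μ] {p : ℝ}
    (hp0 : 0 < p) (hp1 : p < 1) : μ.real (Set.Iio (realQuantile μ p)) ≤ p := by
  obtain ⟨u, hu, hlt, hlim⟩ := exists_seq_strictMono_tendsto (realQuantile μ p)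
  have hU : Set.Iio (realQuantile μ p) ⊆ ⋃ n, Set.Iic (u n) := fun y hy => by
    obtain ⟨n, hn⟩ := (hlim.eventually_const_lt hy).exists
    exact Set.mem_iUnion.mpr ⟨n, le_of_lt hn⟩
  refine ENNReal.toReal_le_of_le_ofReal hp0.le ((measure_mono hU).trans ?_)
  have hmono : Monotone fun n => Set.Iic (u n) := fun i j hij =>
    Set.Iic_subset_Iic.mpr (hu.monotone hij)
  rw [hmono.measure_iUnion]
  refine iSup_le fun n => ?_
  rw [← ofReal_cdf]
  exact ENNReal.ofReal_le_ofReal (cdf_le_of_lt_realQuantile μ hp0 hp1 (hlt n))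

/-! ### Empirical frequencies and deterministic coverage -/

lemma hitCount_mem_nat (S : Set ℝ) (x : ℕ → ℝ) (t : ℕ) : ∃ k : ℕ, hitCount S x t = k := by
  classical
  refine ⟨∑ i ∈ Finset.range t, if x i ∈ S then 1 else 0, ?_⟩
  simp [hitCount, Set.indicator_apply]

lemma empCDF_eq_hitCount (x : ℕ → ℝ) (y : ℝ) (t : ℕ) :
    empCDF (fun j : Fin t => x j) y = hitCount (Set.Iic y) x t / t := by
  simp only [empCDF, hitCount, Set.indicator_apply, Set.mem_Iic]
  rw [Finset.sum_range (fun i => if x i ≤ y then (1 : ℝ) else 0)]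

lemma monotone_empCDF {n : ℕ} (x : Fin n → ℝ) : Monotone (empCDF x) := fun a b hab => by
  refine div_le_div_of_nonneg_right (Finset.sum_le_sum fun i _ => ?_) n.cast_nonneg
  split_ifs <;> linarith

lemma empCDF_le_one_sub_hitCount_Ici (x : ℕ → ℝ) {y b : ℝ} (hyb : y < b) {t : ℕ} (ht : 1 ≤ t) :
    empCDF (fun j : Fin t => x j) y ≤ 1 - hitCount (Set.Ici b) x t / t := by
  have ht' : (0 : ℝ) < t := by exact_mod_cast ht
  rw [empCDF_eq_hitCount, le_sub_iff_add_le, ← add_div, div_le_one ht', hitCount, hitCount,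
    ← Finset.sum_add_distrib]
  calc _ ≤ ∑ i ∈ Finset.range t, (1 : ℝ) := Finset.sum_le_sum fun i _ => by
        simp only [Set.indicator_apply, Set.mem_Iic, Set.mem_Ici]
        split_ifs <;> linarith
    _ = t := by simp

lemma coe_le_one_sub_add {α e h : ℝ} {w : EReal} (hw : w ≠ ⊥) (he : e ≤ 1 - h)
    (h1 : ((α / 2 : ℝ) : EReal) - w ≤ (h : EReal)) :
    (e : EReal) ≤ ((1 - α / 2 : ℝ) : EReal) + w := by
  induction w with
  | bot => exact absurd rfl hw
  | top => rw [EReal.coe_add_top]; simp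
  | coe w =>
    rw [← EReal.coe_sub, EReal.coe_le_coe_iff] at h1
    rw [← EReal.coe_add, EReal.coe_le_coe_iff]
    linarith

lemma coe_lt_one_sub_add {α e h : ℝ} {w : EReal} (hw : w ≠ ⊥) (he : e ≤ 1 - h)
    (h1 : ((α / 2 : ℝ) : EReal) - w < (h : EReal)) :
    (e : EReal) < ((1 - α / 2 : ℝ) : EReal) + w := by
  induction w with
  | bot => exact absurd rfl hw
  | top => rw [EReal.coe_add_top]; simp
  | coe w =>
    rw [← EReal.coe_sub, EReal.coe_lt_coe_iff] at h1
    rw [← EReal.coe_add, EReal.coe_lt_coe_iff]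
    linarith

/-- The right end is treated by counting from above: for `y < b` the empirical distribution function
at `y` is at most one minus the frequency of `[b, ∞)`. Both ends thus need only lower bounds on
frequencies. -/
lemma Icc_subset_predIntervalWide {x : ℕ → ℝ} {t : ℕ} (ht : 1 ≤ t) {α a b : ℝ} {w : EReal}
    (hw : w ≠ ⊥)
    (ha : ((α / 2 : ℝ) : EReal) - w ≤ ((hitCount (Set.Iic a) x t / t : ℝ) : EReal))
    (hb : ((α / 2 : ℝ) : EReal) - w ≤ ((hitCount (Set.Ici b) x t / t : ℝ) : EReal)) :
    Set.Icc a b ⊆ predIntervalWide (fun j : Fin t => x j) α w := by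
  rintro y ⟨hay, hyb⟩
  rw [← empCDF_eq_hitCount] at ha
  constructor
  · refine le_trans (sSup_le ?_) (EReal.coe_le_coe_iff.mpr hay)
    rintro _ ⟨z, rfl, hz⟩
    rw [EReal.coe_le_coe_iff]
    by_contra! haz
    have := EReal.coe_le_coe_iff.mpr (monotone_empCDF (fun j : Fin t => x j) haz.le)
    exact absurd (hz.trans_le (ha.trans this)) (lt_irrefl _)
  · refine (EReal.coe_le_coe_iff.mpr hyb).trans (le_of_forall_lt fun c hc => ?_)
    obtain ⟨z, hcz, hzb⟩ := EReal.lt_iff_exists_real_btwn.mp hc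
    exact hcz.trans_le (le_sSup ⟨z, rfl, coe_le_one_sub_add hw
      (empCDF_le_one_sub_hitCount_Ici x (EReal.coe_lt_coe_iff.mp hzb) ht) hb⟩)

lemma Icc_subset_predInterval {x : ℕ → ℝ} {t : ℕ} (ht : 1 ≤ t) {α a b : ℝ} {w : EReal}
    (hw : w ≠ ⊥)
    (ha : ((α / 2 : ℝ) : EReal) - w < ((hitCount (Set.Iic a) x t / t : ℝ) : EReal))
    (hb : ((α / 2 : ℝ) : EReal) - w < ((hitCount (Set.Ici b) x t / t : ℝ) : EReal)) :
    Set.Icc a b ⊆ predInterval (fun j : Fin t => x j) α w := by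
  rintro y ⟨hay, hyb⟩
  rw [← empCDF_eq_hitCount] at ha
  constructor
  · refine le_trans (sSup_le ?_) (EReal.coe_le_coe_iff.mpr hay)
    rintro _ ⟨z, rfl, hz⟩
    rw [EReal.coe_le_coe_iff]
    by_contra! haz
    have := EReal.coe_le_coe_iff.mpr (monotone_empCDF (fun j : Fin t => x j) haz.le)
    exact absurd (hz.trans_lt (ha.trans_le this)) (lt_irrefl _)
  · refine (EReal.coe_le_coe_iff.mpr hyb).trans (le_of_forall_lt fun c hc => ?_)
    obtain ⟨z, hcz, hzb⟩ := EReal.lt_iff_exists_real_btwn.mp hc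
    exact hcz.trans_le (le_sSup ⟨z, rfl, coe_lt_one_sub_add hw
      (empCDF_le_one_sub_hitCount_Ici x (EReal.coe_lt_coe_iff.mp hzb) ht) hb⟩)

lemma one_sub_le_measureReal_Icc_realQuantile (F : Measure ℝ) [IsProbabilityMeasure F] {p : ℝ}
    (hp0 : 0 < p) (hp1 : p < 1) :
    1 - 2 * p ≤ F.real (Set.Icc (realQuantile F p) (realQuantile F (1 - p))) := by
  set a := realQuantile F p
  set b := realQuantile F (1 - p)
  have h1 : F.real (Set.Iio a) ≤ p := measureReal_Iio_realQuantile_le F hp0 hp1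
  have h2 : 1 - p ≤ F.real (Set.Iic b) :=
    le_measureReal_Iic_realQuantile F (by linarith) (by linarith)
  have h3 : Set.Iic b ⊆ Set.Iio a ∪ Set.Icc a b := fun y hy => by
    rcases lt_or_ge y a with h | h
    · exact Or.inl h
    · exact Or.inr ⟨h, hy⟩
  have h4 := (measureReal_mono (μ := F) h3).trans (measureReal_union_le _ _)
  linarith

lemma le_measureReal_Ici_realQuantile (F : Measure ℝ) [IsProbabilityMeasure F] {p : ℝ}
    (hp0 : 0 < p) (hp1 : p < 1) : p ≤ F.real (Set.Ici (realQuantile F (1 - p))) := by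
  have h := measureReal_Iio_realQuantile_le F (p := 1 - p) (by linarith) (by linarith)
  rw [← Set.compl_Iio, probReal_compl_eq_one_sub measurableSet_Iio]
  linarith

/-- The event that the frequency of `S` falls below the stitched boundary with constant `-z`. -/
def lowFrequency (S : Set ℝ) (p z : ℝ) (g gTail : ℕ → ℝ) (m M : ℕ) : Set (ℕ → ℝ) :=
  {x | ∃ t : ℕ, m ≤ t ∧ ((t ≤ M ∧ hitCount S x t < t * (p + z * g t)) ∨
    (M < t ∧ hitCount S x t ≤ t * (p - gTail t)))}

lemma coe_sub_stitchedWidth_le {p z f : ℝ} {c : EReal} {g gTail : ℕ → ℝ} {M t : ℕ}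
    (hc : ((-z : ℝ) : EReal) ≤ c) (hg : 0 ≤ g t)
    (h1 : t ≤ M → p + z * g t ≤ f) (h2 : M < t → p - gTail t < f) :
    (p : EReal) - stitchedWidth c g gTail M t ≤ (f : EReal) := by
  rw [stitchedWidth]
  split_ifs with ht
  · have : (((-z) * g t : ℝ) : EReal) ≤ c * (g t : EReal) := by
      rw [EReal.coe_mul]
      exact mul_le_mul_of_nonneg_right hc (EReal.coe_nonneg.mpr hg)
    refine (EReal.sub_le_sub le_rfl this).trans ?_
    rw [← EReal.coe_sub, EReal.coe_le_coe_iff]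
    linarith [h1 ht]
  · rw [← EReal.coe_sub, EReal.coe_le_coe_iff]
    exact (h2 (not_le.mp ht)).le

lemma eabs_nonneg (c : EReal) : 0 ≤ eabs c := by
  rcases le_total 0 c with h | h
  · exact h.trans (le_max_left _ _)
  · exact (EReal.neg_nonneg.mpr h).trans (le_max_right _ _)

lemma stitchedWidth_eabs_ne_bot {c : EReal} {g gTail : ℕ → ℝ} {M t : ℕ} (hg : 0 ≤ g t) :
    stitchedWidth (eabs c) g gTail M t ≠ ⊥ := by
  rw [stitchedWidth]
  split_ifs
  · exact ne_bot_of_le_ne_bot EReal.zero_ne_bot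
      (mul_nonneg (eabs_nonneg c) (EReal.coe_nonneg.mpr hg))
  · exact EReal.coe_ne_bot _

lemma sub_stitchedWidth_lt_of_tail {p f : ℝ} {c : EReal} {g gTail : ℕ → ℝ} {M t : ℕ}
    (ht : M < t) (h : p - gTail t < f) :
    (p : EReal) - stitchedWidth c g gTail M t < (f : EReal) := by
  rw [stitchedWidth, if_neg (not_le.mpr ht), ← EReal.coe_sub, EReal.coe_lt_coe_iff]
  exact h

/-- Equality would make `t r` equal to the integer hit count. -/
lemma lt_hitCount_div_of_not_int {S : Set ℝ} {x : ℕ → ℝ} {t : ℕ} (ht : 1 ≤ t) {r : EReal}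
    (hr : ∀ k : ℤ, (t : EReal) * r ≠ ((k : ℝ) : EReal))
    (h : r ≤ ((hitCount S x t / t : ℝ) : EReal)) : r < ((hitCount S x t / t : ℝ) : EReal) := by
  have ht' : (t : ℝ) ≠ 0 := by exact_mod_cast (Nat.one_le_iff_ne_zero.mp ht)
  refine lt_of_le_of_ne h fun he => ?_
  obtain ⟨k, hk⟩ := hitCount_mem_nat S x t
  refine hr k ?_
  rw [he, ← EReal.coe_natCast, ← EReal.coe_mul, mul_div_cancel₀ _ ht', hk]
  simp

/-- Up to `M` the frequency bounds are weak, which suffices for the wide interval. The narrow one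
needs strict bounds, supplied by the tail event after `M` and by non-integrality before. Replacing
`c` by its absolute value can only widen the interval. -/
lemma coverage_of_notMem_lowFrequency (F : Measure ℝ) [IsProbabilityMeasure F] {α : ℝ}
    (hα0 : 0 < α) (hα1 : α < 1) {m M : ℕ} (hm : 1 ≤ m) {g gTail : ℕ → ℝ}
    (hg : ∀ t, m ≤ t → 0 ≤ g t) {z : ℝ} {c : EReal} (hc : ((-z : ℝ) : EReal) ≤ c)
    {x : ℕ → ℝ}
    (h1 : x ∉ lowFrequency (Set.Iic (realQuantile F (α / 2))) (α / 2) z g gTail m M)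
    (h2 : x ∉ lowFrequency (Set.Ici (realQuantile F (1 - α / 2))) (α / 2) z g gTail m M) :
    CoverageEvent F α m M (fun i => stitchedWidth (eabs c) g gTail M i) x := by
  have hdiv : ∀ S : Set ℝ, x ∉ lowFrequency S (α / 2) z g gTail m M → ∀ t, m ≤ t →
      (t ≤ M → α / 2 + z * g t ≤ hitCount S x t / t) ∧
      (M < t → α / 2 - gTail t < hitCount S x t / t) := by
    intro S hS t ht
    have ht' : (0 : ℝ) < t := by exact_mod_cast (hm.trans ht)
    constructor
    · intro htM
      rw [le_div_iff₀' ht']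
      by_contra! h
      exact hS ⟨t, ht, Or.inl ⟨htM, h⟩⟩
    · intro htM
      rw [lt_div_iff₀' ht']
      by_contra! h
      exact hS ⟨t, ht, Or.inr ⟨htM, h⟩⟩
  have hc' : ((-z : ℝ) : EReal) ≤ eabs c := hc.trans (le_max_left _ _)
  have hI := one_sub_le_measureReal_Icc_realQuantile F (p := α / 2) (by linarith) (by linarith)
  rw [mul_div_cancel₀ _ (two_ne_zero' ℝ)] at hI
  intro i hi
  have ha := hdiv _ h1 i hi
  have hb := hdiv _ h2 i hi
  have hw := stitchedWidth_eabs_ne_bot (c := c) (gTail := gTail) (M := M) (hg i hi)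
  have ha' := coe_sub_stitchedWidth_le hc' (hg i hi) ha.1 ha.2
  have hb' := coe_sub_stitchedWidth_le hc' (hg i hi) hb.1 hb.2
  refine ⟨hI.trans (measureReal_mono (Icc_subset_predIntervalWide (hm.trans hi) hw ha' hb')),
    fun hor => hI.trans (measureReal_mono ?_)⟩
  rcases hor with hM | hint
  · exact Icc_subset_predInterval (hm.trans hi) hw (sub_stitchedWidth_lt_of_tail hM (ha.2 hM))
      (sub_stitchedWidth_lt_of_tail hM (hb.2 hM))
  · exact Icc_subset_predInterval (hm.trans hi) hw
      (lt_hitCount_div_of_not_int (hm.trans hi) hint ha')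
      (lt_hitCount_div_of_not_int (hm.trans hi) hint hb')

/-! ### Calibration under `ν` and transfer to the data -/

lemma measurable_minStat (ν : Measure ℝ) (p : ℝ) (g : ℕ → ℝ) {m M : ℕ} (h : m ≤ M) :
    Measurable (minStat ν p g h) := by
  have hq : ∀ t, Measurable fun x : ℕ → ℝ => quantileProcess ν p x t := fun t => by
    refine Finset.measurable_fun_sum _ fun i _ => Measurable.sub_const ?_ p
    exact Measurable.ite (measurableSet_le (measurable_pi_apply i) measurable_const)
      measurable_const measurable_const
  have := Finset.inf'_induction (p := Measurable) (Finset.nonempty_Icc.mpr h)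
    (fun (t : ℕ) (x : ℕ → ℝ) => quantileProcess ν p x t / (t * g t))
    (fun _ h₁ _ h₂ => h₁.inf h₂) fun t _ => (hq t).div_const _
  convert this using 1
  ext x
  simp [minStat, Finset.inf'_apply]

lemma quantileProcess_eq (ν : Measure ℝ) (p : ℝ) (x : ℕ → ℝ) (t : ℕ) :
    quantileProcess ν p x t = hitCount (Set.Iic (realQuantile ν p)) x t - t * p := by
  simp [quantileProcess, hitCount, Set.indicator_apply, Finset.sum_sub_distrib]

instance isProbabilityMeasure_minStatLaw (ν : Measure ℝ) [IsProbabilityMeasure ν] (p : ℝ)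
    (g : ℕ → ℝ) {m M : ℕ} (h : m ≤ M) : IsProbabilityMeasure (minStatLaw ν p g h) :=
  Measure.isProbabilityMeasure_map (measurable_minStat ν p g h).aemeasurable

lemma measure_lowFrequency_quantile_le (ν : Measure ℝ) [IsProbabilityMeasure ν] {p q d : ℝ}
    (hp0 : 0 < p) (hp2 : p ≤ 1 / 2) (hν : cdf ν (realQuantile ν p) = p)
    (hq0 : 0 < q) (hq1 : q < 1) (hd0 : 0 < d) (hd1 : d < 1)
    {s η : ℝ} (hs : 1 < s) (hη : 1 < η) {m M : ℕ} (hm : 1 ≤ m) (h : m ≤ M) {g : ℕ → ℝ}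
    (hg : ∀ t, m ≤ t → 0 < g t) :
    Measure.infinitePi (fun _ : ℕ => ν)
      (lowFrequency (Set.Iic (realQuantile ν p)) p (realQuantile (minStatLaw ν p g h) q) g
        (fun t => boundary s η p d M t) m M) ≤ ENNReal.ofReal (q + d) := by
  set z := realQuantile (minStatLaw ν p g h) q
  -- The inequality must be strict: `Z` takes finitely many values, so its law may have an atom at
  -- `z`, and only the mass strictly below `z` is bounded by `q`.
  have h1 : Measure.infinitePi (fun _ : ℕ => ν) (minStat ν p g h ⁻¹' Set.Iio z) ≤
      ENNReal.ofReal q := by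
    rw [← Measure.map_apply (measurable_minStat ν p g h) measurableSet_Iio]
    change minStatLaw ν p g h (Set.Iio z) ≤ _
    rw [← ofReal_measureReal]
    exact ENNReal.ofReal_le_ofReal (measureReal_Iio_realQuantile_le _ hq0 hq1)
  have h2 := measure_hitCount_boundary_le ν (measurableSet_Iic (a := realQuantile ν p))
    (by rw [← cdf_eq_real, hν]) hp0 hp2 hs hη hd0 hd1 (hm.trans h)
  rw [ENNReal.ofReal_add hq0.le hd0.le]
  refine (measure_mono ?_).trans ((measure_union_le _ _).trans (add_le_add h1 h2))
  rintro x ⟨t, hmt, ⟨htM, hx⟩ | ⟨hMt, hx⟩⟩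
  · left
    have ht' : (0 : ℝ) < t := by exact_mod_cast (hm.trans hmt)
    have hgt := hg t hmt
    simp only [Set.mem_preimage, Set.mem_Iio, minStat, Finset.inf'_lt_iff]
    refine ⟨t, Finset.mem_Icc.mpr ⟨hmt, htM⟩, ?_⟩
    rw [div_lt_iff₀ (by positivity), quantileProcess_eq]
    linarith
  · exact Or.inr ⟨t, hMt.le, hx⟩

lemma measure_lowFrequency_le {Ω : Type*} [MeasurableSpace Ω] {P : Measure Ω}
    [IsProbabilityMeasure P] {F : Measure ℝ} [IsProbabilityMeasure F] {X : ℕ → Ω → ℝ}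
    (hX : ∀ i, HasLaw (X i) F P) (hXind : iIndepFun X P) (ν : Measure ℝ)
    [IsProbabilityMeasure ν] {p z : ℝ} (hν : cdf ν (realQuantile ν p) = p) {S : Set ℝ}
    (hS : MeasurableSet S) (hFS : p ≤ F.real S) (g gTail : ℕ → ℝ) (m M : ℕ) :
    P {ω | (fun i => X i ω) ∈ lowFrequency S p z g gTail m M} ≤
      Measure.infinitePi (fun _ : ℕ => ν)
        (lowFrequency (Set.Iic (realQuantile ν p)) p z g gTail m M) := by
  -- The bad event in terms of the indicator sequence alone, where it is visibly a lower set.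
  let E : Set (ℕ → ℝ) := {b | ∃ t : ℕ, m ≤ t ∧
    ((t ≤ M ∧ ∑ i ∈ Finset.range t, b i < t * (p + z * g t)) ∨
    (M < t ∧ ∑ i ∈ Finset.range t, b i ≤ t * (p - gTail t)))}
  have hsum : ∀ t, Measurable fun b : ℕ → ℝ => ∑ i ∈ Finset.range t, b i := fun t =>
    Finset.measurable_fun_sum _ fun i _ => measurable_pi_apply i
  have hE : MeasurableSet E := by
    simp only [E, Set.ofPred_exists]
    refine MeasurableSet.iUnion fun t => (MeasurableSet.const _).inter
      (((MeasurableSet.const _).inter ?_).union ((MeasurableSet.const _).inter ?_))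
    · exact measurableSet_lt (hsum t) measurable_const
    · exact measurableSet_le (hsum t) measurable_const
  have hlow : IsLowerSet E := by
    rintro b b' hb ⟨t, hmt, ht⟩
    have hle : ∑ i ∈ Finset.range t, b' i ≤ ∑ i ∈ Finset.range t, b i :=
      Finset.sum_le_sum fun i _ => hb i
    exact ⟨t, hmt, ht.imp (fun h => ⟨h.1, hle.trans_lt h.2⟩) fun h => ⟨h.1, hle.trans h.2⟩⟩
  have hlaw := hXind.hasLaw_infinitePi hX (aemeasurable_pi_iff.2 fun i => (hX i).aemeasurable)
  have hSm : Measurable (S.indicator fun _ => (1 : ℝ)) := measurable_const.indicator hS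
  have hEm : MeasurableSet {x : ℕ → ℝ | (fun i => S.indicator (fun _ => (1 : ℝ)) (x i)) ∈ E} :=
    (measurable_pi_lambda _ fun i => hSm.comp (measurable_pi_apply i)) hE
  have hm := infinitePi_indicator_mono F ν hS (measurableSet_Iic (a := realQuantile ν p))
    (by
      rw [← ofReal_measureReal, ← ofReal_measureReal, ← cdf_eq_real, hν]
      exact ENNReal.ofReal_le_ofReal hFS) hE hlow
  exact (hlaw.measure_eq (p := fun x => x ∈ lowFrequency S p z g gTail m M) hEm).trans_le hm

/-- Only subadditivity is used, so none of the events has to be measurable. -/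
lemma one_sub_add_le_measureReal {Ω : Type*} [MeasurableSpace Ω] {P : Measure Ω}
    [IsProbabilityMeasure P] {G B₁ B₂ : Ω → Prop} (h : ∀ ω, ¬ B₁ ω → ¬ B₂ ω → G ω) {a b : ℝ}
    (h₁ : P.real {ω | B₁ ω} ≤ a) (h₂ : P.real {ω | B₂ ω} ≤ b) :
    1 - (a + b) ≤ P.real {ω | G ω} := by
  have hsub : (Set.univ : Set Ω) ⊆ {ω | G ω} ∪ ({ω | B₁ ω} ∪ {ω | B₂ ω}) := by
    intro ω _
    by_cases b₁ : B₁ ω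
    · exact Or.inr (Or.inl b₁)
    by_cases b₂ : B₂ ω
    · exact Or.inr (Or.inr b₂)
    exact Or.inl (h ω b₁ b₂)
  have h3 := measureReal_mono (μ := P) hsub
  have h4 := measureReal_union_le (μ := P) {ω | G ω} ({ω | B₁ ω} ∪ {ω | B₂ ω})
  have h5 := measureReal_union_le (μ := P) {ω | B₁ ω} {ω | B₂ ω}
  rw [probReal_univ] at h3
  linarith

/-! ### Confidence bound for the simulated quantile -/

/-- Bennett's inequality for the empirical distribution function below a point whose probability
is at least `q`. -/
lemma measure_empCDF_le_bennett {Ω : Type*} [MeasurableSpace Ω] {P : Measure Ω}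
    [IsProbabilityMeasure P] {μ : Measure ℝ} [IsProbabilityMeasure μ] {N : ℕ} {Z : Fin N → Ω → ℝ}
    (hZ : ∀ k, HasLaw (Z k) μ P) (hZind : iIndepFun Z P) {q ε y : ℝ} (hq0 : 0 < q) (hq1 : q < 1)
    (hε : 0 < ε) (hy : q ≤ μ.real (Set.Iic y)) (hN : 0 < N) :
    P.real {ω | empCDF (fun k => Z k ω) y ≤ q - ε} ≤
      Real.exp (-(N * (q * (1 - q)) * bennettH (ε / (q * (1 - q))))) := by
  have hN' : (0 : ℝ) < N := by exact_mod_cast hN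
  have hv : 0 < q * (1 - q) := mul_pos hq0 (by linarith)
  set u := ε / (q * (1 - q)) with hu
  have hu0 : 0 < u := by positivity
  set l := Real.log (1 + u)
  have hl : 0 ≤ l := Real.log_nonneg (by linarith)
  let φ : ℝ → ℝ := (Set.Iic y).indicator fun _ => 1
  have hφ : Measurable φ := measurable_const.indicator measurableSet_Iic
  have hφ0 : ∀ x, 0 ≤ φ x := fun x => Set.indicator_nonneg (by simp) x
  let B : Fin N → Ω → ℝ := fun k ω => φ (Z k ω)
  have hBm : ∀ k, AEMeasurable (B k) P := fun k => hφ.comp_aemeasurable (hZ k).aemeasurable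
  have hBind : iIndepFun B P := hZind.comp (fun _ => φ) fun _ => hφ
  have hmgf : ∀ k, mgf (B k) P (-l) =
      1 - μ.real (Set.Iic y) + μ.real (Set.Iic y) * Real.exp (-l) := by
    intro k
    rw [← integral_exp_mul_indicator μ measurableSet_Iic, mgf,
      ← (hZ k).integral_comp (f := fun x => Real.exp (-l * φ x)) (by fun_prop)]
    rfl
  have hmgf_le : ∀ k, mgf (B k) P (-l) ≤
      Real.exp (-(q * l) + q * (1 - q) * (Real.exp l - 1 - l)) := by
    intro k
    rw [hmgf]
    refine le_trans ?_ (bernoulli_mgf_neg_le_bennett hq0.le hq1.le hl)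
    -- The moment generating function at `-l` decreases in the mass, so the mass may be lowered to
    -- `q`.
    have : Real.exp (-l) ≤ 1 := Real.exp_le_one_iff.mpr (by linarith)
    nlinarith
  have hint : Integrable (fun ω => Real.exp (-l * (∑ k, B k) ω)) P := by
    have hs : AEMeasurable (∑ k, B k) P := Finset.aemeasurable_sum _ fun k _ => hBm k
    refine Integrable.of_bound (C := 1) (by fun_prop) (ae_of_all _ fun ω => ?_)
    rw [Real.norm_of_nonneg (Real.exp_pos _).le, Real.exp_le_one_iff, Finset.sum_apply]
    have : 0 ≤ ∑ k, B k ω := Finset.sum_nonneg fun k _ => hφ0 _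
    nlinarith
  have hch := measure_le_le_exp_mul_mgf (μ := P) (X := ∑ k, B k) (t := -l) (N * (q - ε))
    (by linarith) hint
  rw [hBind.mgf_sum₀ hBm] at hch
  have hprod : ∏ k, mgf (B k) P (-l) ≤
      Real.exp (-(q * l) + q * (1 - q) * (Real.exp l - 1 - l)) ^ N := by
    refine (Finset.prod_le_prod (fun k _ => mgf_nonneg) fun k _ => hmgf_le k).trans ?_
    simp
  have hset : {ω | empCDF (fun k => Z k ω) y ≤ q - ε} = {ω | (∑ k, B k) ω ≤ N * (q - ε)} := by
    ext ω
    simp only [Set.mem_ofPred_eq, empCDF, Finset.sum_apply, B, φ, Set.indicator_apply, Set.mem_Iic]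
    rw [div_le_iff₀' hN']
  rw [hset]
  refine hch.trans ((mul_le_mul_of_nonneg_left hprod (Real.exp_pos _).le).trans_eq ?_)
  rw [← Real.exp_nat_mul, ← Real.exp_add]
  congr 1
  have := bennettH_exponent hv hε
  linear_combination (N : ℝ) * this

/-- If the empirical quantile at level `q - ε` exceeds `Q(q)`, then the empirical distribution
function at `Q(q)` is at most `q - ε`, although that half-line has mass at least `q`. -/
lemma measure_upperQuantile_empCDF_le_compl_le {Ω : Type*} [MeasurableSpace Ω] {P : Measure Ω}
    [IsProbabilityMeasure P] {μ : Measure ℝ} [IsProbabilityMeasure μ] {N : ℕ} {Z : Fin N → Ω → ℝ}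
    (hZ : ∀ k, HasLaw (Z k) μ P) (hZind : iIndepFun Z P) {q ε : ℝ} (hq0 : 0 < q) (hq1 : q < 1)
    (hε : 0 < ε) :
    P.real {ω | upperQuantile (empCDF fun k => Z k ω) ((q - ε : ℝ) : EReal) ≤
      upperQuantile (cdf μ) (q : EReal)}ᶜ ≤
      Real.exp (-(N * (q * (1 - q)) * bennettH (ε / (q * (1 - q))))) := by
  rcases Nat.eq_zero_or_pos N with rfl | hN
  -- With no simulated copies the bound is `exp 0 = 1`.
  · simp
  refine (measureReal_mono ?_).trans (measure_empCDF_le_bennett hZ hZind hq0 hq1 hε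
    (le_measureReal_Iic_realQuantile μ hq0 hq1) hN)
  intro ω hω
  rw [Set.mem_compl_iff, Set.mem_ofPred_eq, not_le] at hω
  obtain ⟨_, ⟨x, rfl, hx⟩, hlt⟩ := lt_sSup_iff.mp hω
  rw [← coe_realQuantile μ hq0 hq1, EReal.coe_lt_coe_iff] at hlt
  exact (monotone_empCDF _ hlt.le).trans (EReal.coe_le_coe_iff.mp hx)

end QuantilePAC

end

/-! ### The guarantee -/

open QuantilePAC in
theorem mainTheorem3
    {Ω Ω' : Type*} [MeasurableSpace Ω] [MeasurableSpace Ω']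
    (P : Measure Ω) [IsProbabilityMeasure P] (P' : Measure Ω') [IsProbabilityMeasure P']
    -- levels
    (α δ δ' : ℝ) (hα : α ∈ Set.Ioo (0 : ℝ) 1) (hδ : δ ∈ Set.Ioo (0 : ℝ) 1)
    (hδ' : δ' ∈ Set.Ioo (0 : ℝ) 1)
    -- waiting time `m`, cutoff `M`
    (m M : ℕ) (hm : 1 ≤ m) (hmM : m ≤ M)
    -- parameters of the normalising boundary `g` (on `[m, M]`) and of the tail boundary
    (s η : ℝ) (hs : 1 < s) (hη : 1 < η) (m₀ : ℕ) (hm₀ : 1 ≤ m₀) (hm₀m : m₀ ≤ m)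
    (sT ηT : ℝ) (hsT : 1 < sT) (hηT : 1 < ηT)
    (g gTail : ℕ → ℝ) (hg : g = fun t => boundary s η (α / 2) (δ / 4) m₀ t)
    (hgTail : gTail = fun t => boundary sT ηT (α / 2) (δ / 4) M t)
    -- the data: an i.i.d. sequence with law `F`
    (F : Measure ℝ) [IsProbabilityMeasure F] (X : ℕ → Ω → ℝ)
    (hX : ∀ i, HasLaw (X i) F P) (hXind : iIndepFun X P)
    -- the distribution used to simulate the process `S_t`, for which `P(X ≤ Q(p)) = p`
    (ν : Measure ℝ) [IsProbabilityMeasure ν]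
    (hν : cdf ν (realQuantile ν (α / 2)) = α / 2)
    -- the simulation: `N` independent copies of `Z`
    (N : ℕ) (Z : Fin N → Ω' → ℝ)
    (hZ : ∀ k, HasLaw (Z k) (minStatLaw ν (α / 2) g hmM) P') (hZind : iIndepFun Z P')
    -- the margin of the lower confidence bound for the `δ/4`-quantile of `Z`
    (ε : ℝ) (hε : 0 < ε)
    (hεδ' : Real.exp (-(N * (δ / 4 * (1 - δ / 4)) *
      bennettH (ε / (δ / 4 * (1 - δ / 4))))) ≤ δ')
    (cZ : Ω' → EReal) (hcZ : cZ = fun ω' => simConst (fun k => Z k ω') (δ / 4) ε)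
    (A : Set Ω')
    (hA : A = {ω' | upperQuantile (empCDF fun k => Z k ω') ((δ / 4 - ε : ℝ) : EReal) ≤
      upperQuantile (cdf (minStatLaw ν (α / 2) g hmM)) ((δ / 4 : ℝ) : EReal)}) :
    -- `A` has probability at least `1 - δ'`
    1 - δ' ≤ P'.real A ∧
    -- on `A`, the stitched boundary is a time-uniform bound for the quantile process
    (∀ ω' ∈ A,
      P.real {ω | ∃ t : ℕ, m ≤ t ∧
        ((empCDF (fun j : Fin t => X j ω) (realQuantile F (α / 2)) : ℝ) : EReal) <
          ((α / 2 : ℝ) : EReal) - stitchedWidth (cZ ω') g gTail M t} ≤ δ / 2) ∧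
    -- on `A`, all prediction intervals have the required coverage with probability `1 - δ`
    (∀ ω' ∈ A,
      1 - δ ≤ P.real {ω | CoverageEvent F α m M
        (fun i => stitchedWidth (eabs (cZ ω')) g gTail M i) (fun j => X j ω)}) ∧
    -- the resulting `(δ', δ, α)` guarantee
    1 - δ' ≤ P'.real {ω' | 1 - δ ≤ P.real {ω | CoverageEvent F α m M
        (fun i => stitchedWidth (eabs (cZ ω')) g gTail M i) (fun j => X j ω)}} := by
  have hp0 : 0 < α / 2 := by linarith [hα.1]
  have hp2 : α / 2 ≤ 1 / 2 := by linarith [hα.2]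
  have hq0 : 0 < δ / 4 := by linarith [hδ.1]
  have hq1 : δ / 4 < 1 := by linarith [hδ.2]
  have hg0 : ∀ t, m ≤ t → 0 < g t := fun t ht => by
    rw [hg]
    exact boundary_pos hs hη hq0 hq1 hp0 hp2 hm₀ (hm₀m.trans ht)
  have hAprob : 1 - δ' ≤ P'.real A := by
    have h1 := measure_upperQuantile_empCDF_le_compl_le hZ hZind hq0 hq1 hε
    rw [← hA] at h1
    have h2 := measureReal_union_le (μ := P') A Aᶜ
    rw [Set.union_compl_self, probReal_univ] at h2
    linarith
  set z := realQuantile (minStatLaw ν (α / 2) g hmM) (δ / 4)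
  have hcA : ∀ ω' ∈ A, ((-z : ℝ) : EReal) ≤ cZ ω' := fun ω' hω' => by
    rw [hA, Set.mem_ofPred_eq, ← coe_realQuantile _ hq0 hq1] at hω'
    rw [hcZ, EReal.coe_neg]
    exact EReal.neg_le_neg_iff.mpr hω'
  have hbad : ∀ S : Set ℝ, MeasurableSet S → α / 2 ≤ F.real S →
      P.real {ω | (fun i => X i ω) ∈ lowFrequency S (α / 2) z g gTail m M} ≤ δ / 2 := by
    intro S hS hFS
    refine ENNReal.toReal_le_of_le_ofReal (by linarith) ?_
    refine (measure_lowFrequency_le hX hXind ν hν hS hFS g gTail m M).trans ?_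
    rw [hgTail]
    refine (measure_lowFrequency_quantile_le ν hp0 hp2 hν hq0 hq1 hq0 hq1 hsT hηT hm hmM
      hg0).trans_eq ?_
    congr 1
    ring
  have hbad1 := hbad _ measurableSet_Iic (le_measureReal_Iic_realQuantile F hp0 (by linarith))
  have hbad2 := hbad _ measurableSet_Ici (le_measureReal_Ici_realQuantile F hp0 (by linarith))
  have hcov : ∀ ω' ∈ A, 1 - δ ≤ P.real {ω | CoverageEvent F α m M
      (fun i => stitchedWidth (eabs (cZ ω')) g gTail M i) (fun j => X j ω)} := by
    intro ω' hω'
    have h := one_sub_add_le_measureReal (P := P)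
      (fun ω (h1 : (fun j => X j ω) ∉ lowFrequency _ _ _ _ _ _ _)
        (h2 : (fun j => X j ω) ∉ lowFrequency _ _ _ _ _ _ _) =>
        coverage_of_notMem_lowFrequency F hα.1 hα.2 hm (fun t ht => (hg0 t ht).le)
          (hcA ω' hω') h1 h2) hbad1 hbad2
    rwa [add_halves] at h
  -- The last claim holds because `A` is contained in the set of good simulations. The second
  -- follows from the bad event for `(-∞, Q(p)]` alone, with `c_Z` itself rather than its absolute
  -- value.
  refine ⟨hAprob, fun ω' hω' => ?_, hcov, hAprob.trans (measureReal_mono hcov)⟩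
  refine (measureReal_mono ?_).trans hbad1
  rintro ω ⟨t, hmt, ht⟩
  by_contra hω
  have ht' : (0 : ℝ) < t := by exact_mod_cast (hm.trans hmt)
  refine absurd ht (not_lt.mpr ?_)
  rw [empCDF_eq_hitCount (fun j => X j ω)]
  refine coe_sub_stitchedWidth_le (hcA ω' hω') (hg0 t hmt).le (fun htM => ?_) fun hMt => ?_
  · rw [le_div_iff₀' ht']
    by_contra! h
    exact hω ⟨t, hmt, Or.inl ⟨htM, h⟩⟩
  · rw [lt_div_iff₀' ht']
    by_contra! h
    exact hω ⟨t, hmt, Or.inr ⟨hMt, h⟩⟩
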